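/- **Definitions.** For a frame $L$ let $K(L)$ be its set of compact elements, and let $\to$ be the implication of $L$ (every frame is a complete Heyting algebra). A *Heyting frame* is an algebraic frame $L$ (each element is a join of compact elements) such that $K(L)$ is a Heyting subalgebra of $L$. For a subset $S$ of a poset, ${\downarrow}S$ is the downset generated by $S$; $\mathrm{cl}$ denotes topological closure. - $\mathsf{HeytFrm}^\dagger$ is the category of Heyting frames and maps $\alpha:L\to M$ that preserve arbitrary meets, arbitrary joins and implication, and satisfy $\alpha[K(L)]\subseteq K(M)$. - For a Heyting algebra $A$, let $\mathcal J(A)$ be the frame of ideals of $A$ ordered by inclusion; for a bounded lattice homomorphism $h:A\to B$ let $h^*:\mathcal J(A)\to\mathcal J(B)$, $h^*(I)={\downarrow}h[I]$. $\mathsf{HA}^+$ (respectively $\mathsf{HA}^*$) is the category of Heyting algebras and bounded lattice homomorphisms $h$ such that $h^*$ is a Heyting algebra homomorphism (respectively, a complete lattice homomorphism). Put $\mathsf{HA}^\dagger=\mathsf{HA}^+\cap\mathsf{HA}^*$: all Heyting algebras, with the morphisms that lie in both. - An *Esakia space* is a poset $X$ with a compact topology such that whenever $x\not\le y$ there is a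 clopen upset containing $x$ but not $y$, and such that ${\downarrow}U$ is clopen for each clopen $U\subseteq X$. A subset of $X$ is *E-constructible* if it is a finite union of sets $U\setminus V$ with $U,V$ open upsets. $\mathsf{ES}^+$ (respectively $\mathsf{ES}^*$) is the category of Esakia spaces and continuous order-preserving maps $f:X\to Y$ such that $f^{-1}({\downarrow}\,\mathrm{cl}\,E)={\downarrow}\,\mathrm{cl}\,f^{-1}(E)$ for each E-constructible $E\subseteq Y$ (respectively, for each downset $E\subseteq Y$). Put $\mathsf{ES}^\dagger=\mathsf{ES}^+\cap\mathsf{ES}^*$: all Esakia spaces, with the morphisms that lie in both. **Corollary.** $\mathsf{HeytFrm}^\dagger$ is equivalent to $\mathsf{HA}^\dagger$ and dually equivalent to $\mathsf{ES}^\dagger$. -/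

import Mathlib

open CategoryTheory

universe u

namespace HeytingFrames

/-! ### Heyting frames -/

/-- The elements of `L` that are compact: `a ≤ ⋁ S` implies `a ≤ ⋁ T` for some finite `T ⊆ S`
(by `CompleteLattice.isCompactElement_iff_exists_le_sSup_of_le_sSup`, Mathlib's definition through
directed sets is the same). -/
def compactElements (L : Type u) [Order.Frame L] : Set L := {a | IsCompactElement a}

/-- A Heyting frame: an algebraic frame (each element is a join of compact elements) in which
the compact elements form a Heyting subalgebra. -/
structure IsHeytingFrame (L : Type u) [Order.Frame L] : Prop where
  algebraic : ∀ x : L, ∃ S ⊆ compactElements L, sSup S = x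
  bot_mem : ⊥ ∈ compactElements L
  top_mem : ⊤ ∈ compactElements L
  sup_mem : ∀ a ∈ compactElements L, ∀ b ∈ compactElements L, a ⊔ b ∈ compactElements L
  inf_mem : ∀ a ∈ compactElements L, ∀ b ∈ compactElements L, a ⊓ b ∈ compactElements L
  himp_mem : ∀ a ∈ compactElements L, ∀ b ∈ compactElements L, a ⇨ b ∈ compactElements L

/-- The objects of the category of Heyting frames and complete Heyting homomorphisms preserving
compact elements. -/
structure HeytFrmDagger where
  carrier : Type u
  [frame : Order.Frame carrier]
  isHeytingFrame : IsHeytingFrame carrier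

namespace HeytFrmDagger

attribute [instance] HeytFrmDagger.frame

instance : CoeSort HeytFrmDagger.{u} (Type u) := ⟨HeytFrmDagger.carrier⟩

/-- Complete Heyting homomorphisms (maps preserving arbitrary meets, arbitrary joins and
implication) that send compact elements to compact elements. -/
@[ext]
structure Hom (L M : HeytFrmDagger.{u}) where
  toCompleteLatticeHom : CompleteLatticeHom L M
  map_himp : ∀ a b : L,
    toCompleteLatticeHom (a ⇨ b) = toCompleteLatticeHom a ⇨ toCompleteLatticeHom b
  map_compact : ∀ a ∈ compactElements L, toCompleteLatticeHom a ∈ compactElements M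

instance : Category HeytFrmDagger.{u} where
  Hom L M := Hom L M
  id L := ⟨CompleteLatticeHom.id L, fun _ _ => rfl, fun _ ha => ha⟩
  comp f g := ⟨g.toCompleteLatticeHom.comp f.toCompleteLatticeHom,
    fun a b => by simp [f.map_himp, g.map_himp],
    fun a ha => g.map_compact _ (f.map_compact a ha)⟩

end HeytFrmDagger

/-! ### The frame of ideals of a bounded distributive lattice -/

section Ideals

variable {A : Type u} [DistribLattice A] [BoundedOrder A]

/-- The implication `I → J = {a | a ⊓ b ∈ J for all b ∈ I}` of ideals. -/
def idealHimp (I J : Order.Ideal A) : Order.Ideal A where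
  carrier := {a | ∀ b ∈ I, a ⊓ b ∈ J}
  lower' := fun _ _ hca ha b hb => J.lower (inf_le_inf_right b hca) (ha b hb)
  nonempty' := ⟨⊥, fun b _ => by simp⟩
  directed' := fun a ha c hc => ⟨a ⊔ c, fun b hb => by
    rw [inf_sup_right]
    exact Order.Ideal.sup_mem (ha b hb) (hc b hb), le_sup_left, le_sup_right⟩

theorem le_idealHimp_iff (N I J : Order.Ideal A) : N ≤ idealHimp I J ↔ N ⊓ I ≤ J := by
  constructor
  · intro h a ha
    have h1 : a ⊓ a ∈ J := h (Order.Ideal.mem_inf.1 ha).1 a (Order.Ideal.mem_inf.1 ha).2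
    rwa [inf_idem] at h1
  · intro h a ha b hb
    exact h (Order.Ideal.mem_inf.2 ⟨N.lower inf_le_left ha, I.lower inf_le_right hb⟩)

/-- The ideals of a bounded distributive lattice, ordered by inclusion, form a frame. -/
instance : Order.Frame (Order.Ideal A) where
  __ := (inferInstance : CompleteLattice (Order.Ideal A))
  himp := idealHimp
  le_himp_iff := le_idealHimp_iff
  compl I := idealHimp I ⊥
  himp_bot _ := rfl

variable {B : Type u} [DistribLattice B] [BoundedOrder B]

/-- For a bounded lattice homomorphism `h : A → B`, the map `h* : J(A) → J(B)` sending an ideal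
`I` to the downset generated by the image `h[I]`. -/
def idealMap (h : BoundedLatticeHom A B) (I : Order.Ideal A) : Order.Ideal B where
  carrier := {b | ∃ a ∈ I, b ≤ h a}
  lower' := fun _ _ hcb ⟨a, ha, hb⟩ => ⟨a, ha, hcb.trans hb⟩
  nonempty' := ⟨⊥, ⊥, I.bot_mem, bot_le⟩
  directed' := fun b ⟨a, ha, hb⟩ c ⟨d, hd, hc⟩ =>
    ⟨b ⊔ c, ⟨a ⊔ d, Order.Ideal.sup_mem ha hd, by rw [map_sup]; exact sup_le_sup hb hc⟩,
      le_sup_left, le_sup_right⟩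

theorem mem_idealMap {h : BoundedLatticeHom A B} {I : Order.Ideal A} {b : B} :
    b ∈ idealMap h I ↔ ∃ a ∈ I, b ≤ h a := Iff.rfl

theorem idealMap_id : idealMap (BoundedLatticeHom.id A) = id := by
  funext I
  ext b
  exact ⟨fun ⟨_, ha, hb⟩ => I.lower hb ha, fun hb => ⟨b, hb, le_rfl⟩⟩

theorem idealMap_comp {C : Type u} [DistribLattice C] [BoundedOrder C]
    (g : BoundedLatticeHom B C) (h : BoundedLatticeHom A B) :
    idealMap (g.comp h) = idealMap g ∘ idealMap h := by
  funext I
  ext c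
  constructor
  · rintro ⟨a, ha, hc⟩
    exact ⟨h a, ⟨a, ha, le_rfl⟩, hc⟩
  · rintro ⟨b, ⟨a, ha, hb⟩, hc⟩
    exact ⟨a, ha, hc.trans (OrderHomClass.mono g hb)⟩

end Ideals

/-! ### Categories of Heyting algebras -/

/-- The objects of the category of Heyting algebras and bounded lattice homomorphisms. -/
structure HAMinus where
  carrier : Type u
  [heytingAlgebra : HeytingAlgebra carrier]

namespace HAMinus

attribute [instance] HAMinus.heytingAlgebra

instance : CoeSort HAMinus.{u} (Type u) := ⟨HAMinus.carrier⟩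

instance : Category HAMinus.{u} where
  Hom A B := BoundedLatticeHom A B
  id A := BoundedLatticeHom.id A
  comp f g := BoundedLatticeHom.comp g f

end HAMinus

/-- The bounded lattice homomorphisms `h : A → B` for which `h* : J(A) → J(B)` is a homomorphism
of Heyting algebras. -/
def haPlus : MorphismProperty HAMinus.{u} := fun A B (h : BoundedLatticeHom A B) =>
  ∃ φ : HeytingHom (Order.Ideal A) (Order.Ideal B), ⇑φ = idealMap h

/-- The bounded lattice homomorphisms `h : A → B` for which `h* : J(A) → J(B)` is a complete
lattice homomorphism. -/
def haStar : MorphismProperty HAMinus.{u} := fun A B (h : BoundedLatticeHom A B) =>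
  ∃ φ : CompleteLatticeHom (Order.Ideal A) (Order.Ideal B), ⇑φ = idealMap h

instance : haPlus.{u}.IsMultiplicative where
  id_mem A := ⟨HeytingHom.id _, (idealMap_id (A := A)).symm⟩
  comp_mem := by
    rintro A B C f g ⟨φ, hφ⟩ ⟨ψ, hψ⟩
    exact ⟨ψ.comp φ, by rw [HeytingHom.coe_comp, hφ, hψ]; exact (idealMap_comp g f).symm⟩

instance : haStar.{u}.IsMultiplicative where
  id_mem A := ⟨CompleteLatticeHom.id _, (idealMap_id (A := A)).symm⟩
  comp_mem := by
    rintro A B C f g ⟨φ, hφ⟩ ⟨ψ, hψ⟩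
    exact ⟨ψ.comp φ, by rw [CompleteLatticeHom.coe_comp, hφ, hψ]; exact (idealMap_comp g f).symm⟩

/-- The wide subcategory of `HAMinus` whose morphisms lie in both `haPlus` and `haStar`. -/
abbrev HADagger := WideSubcategory (haPlus.{u} ⊓ haStar.{u})

/-! ### Categories of Esakia spaces -/

/-- The downset generated by `S`. -/
def down {X : Type u} [PartialOrder X] (S : Set X) : Set X := {x | ∃ s ∈ S, x ≤ s}

/-- The objects of the category of Esakia spaces and Priestley morphisms: an Esakia space is a
(compact) Priestley space in which the downset of each clopen set is clopen. -/
structure ESMinus where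
  carrier : Type u
  [topologicalSpace : TopologicalSpace carrier]
  [partialOrder : PartialOrder carrier]
  [compactSpace : CompactSpace carrier]
  [priestleySpace : PriestleySpace carrier]
  isClopen_down : ∀ U : Set carrier, IsClopen U → IsClopen (down U)

namespace ESMinus

attribute [instance] ESMinus.topologicalSpace ESMinus.partialOrder ESMinus.compactSpace
  ESMinus.priestleySpace

instance : CoeSort ESMinus.{u} (Type u) := ⟨ESMinus.carrier⟩

/-- Morphisms are the continuous order-preserving maps. -/
instance : Category ESMinus.{u} where
  Hom X Y := ContinuousOrderHom X Y
  id X := ContinuousOrderHom.id X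
  comp f g := ContinuousOrderHom.comp g f

end ESMinus

/-- Finite unions of sets `U \ V` with `U`, `V` open upsets. -/
def IsEConstructible {X : Type u} [TopologicalSpace X] [PartialOrder X] (E : Set X) : Prop :=
  ∃ F : Set (Set X), F.Finite ∧
    (∀ S ∈ F, ∃ U V : Set X, (IsOpen U ∧ IsUpperSet U) ∧ (IsOpen V ∧ IsUpperSet V) ∧ S = U \ V) ∧
    E = ⋃₀ F

theorem IsEConstructible.preimage {X Y : Type u} [TopologicalSpace X] [PartialOrder X]
    [TopologicalSpace Y] [PartialOrder Y] (f : ContinuousOrderHom X Y) {E : Set Y}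
    (hE : IsEConstructible E) : IsEConstructible (f ⁻¹' E) := by
  obtain ⟨F, hF, hS, rfl⟩ := hE
  refine ⟨(f ⁻¹' ·) '' F, hF.image _, ?_, ?_⟩
  · rintro _ ⟨S, hSF, rfl⟩
    obtain ⟨U, V, ⟨hU, hU'⟩, ⟨hV, hV'⟩, rfl⟩ := hS S hSF
    have hc : Continuous f := f.continuous_toFun
    have hm : Monotone f := f.monotone'
    exact ⟨f ⁻¹' U, f ⁻¹' V, ⟨hU.preimage hc, hU'.preimage hm⟩,
      ⟨hV.preimage hc, hV'.preimage hm⟩, rfl⟩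
  · rw [Set.preimage_sUnion, Set.sUnion_image]

/-- The Priestley morphisms `f : X → Y` with `f⁻¹(↓ cl E) = ↓ cl f⁻¹(E)` for each E-constructible
subset `E` of `Y`. -/
def esPlus : MorphismProperty ESMinus.{u} := fun X Y (f : ContinuousOrderHom X Y) =>
  ∀ E : Set Y, IsEConstructible E → f ⁻¹' down (closure E) = down (closure (f ⁻¹' E))

/-- The Priestley morphisms `f : X → Y` with `f⁻¹(↓ cl D) = ↓ cl f⁻¹(D)` for each downset `D`
of `Y`. -/
def esStar : MorphismProperty ESMinus.{u} := fun X Y (f : ContinuousOrderHom X Y) =>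
  ∀ D : Set Y, IsLowerSet D → f ⁻¹' down (closure D) = down (closure (f ⁻¹' D))

instance : esPlus.{u}.IsMultiplicative where
  id_mem _ := fun _ _ => rfl
  comp_mem {X Y Z} (f : ContinuousOrderHom X Y) (g : ContinuousOrderHom Y Z) hf hg := fun E hE =>
    (congrArg (f ⁻¹' ·) (hg E hE)).trans (hf _ (hE.preimage g))

instance : esStar.{u}.IsMultiplicative where
  id_mem _ := fun _ _ => rfl
  comp_mem {X Y Z} (f : ContinuousOrderHom X Y) (g : ContinuousOrderHom Y Z) hf hg := fun D hD =>
    (congrArg (f ⁻¹' ·) (hg D hD)).trans (hf _ (hD.preimage g.monotone'))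

/-- The wide subcategory of `ESMinus` whose morphisms lie in both `esPlus` and `esStar`. -/
abbrev ESDagger := WideSubcategory (esPlus.{u} ⊓ esStar.{u})

end HeytingFrames

/-! Both statements come from functors into Heyting frames that are full, faithful and essentially
surjective. For `idealFunctor`, compact ideals are exactly the principal ones
(`mem_compactElements_ideal`), so `A` is recovered as the compact elements of its ideal frame. A
complete homomorphism preserving compact elements restricts to principal ideals and is determined
there (`exists_eq_idealMap`); the conditions on `h*` say precisely that it is a morphism of the
target. Algebraicity makes each Heyting frame the ideal frame of its compact elements. For
`upsetFunctor`, the compact open upsets are the clopen ones. The exterior `(↓ cl D)ᶜ` expresses both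
operations that preimages need not preserve: `U ⇨ V` is the exterior of `U \ V`, and `sInf S` is the
exterior of the union of the complements. Hence the conditions on Esakia morphisms amount to
preservation of implications and meets. Compactness produces a point map from a frame homomorphism
(`exists_eq_upsetPreimage`), and the prime filters of the compact elements give essential
surjectivity (`idealOrderIso`). -/

namespace HeytingFrames

/-! ### Compact ideals and principal ideals. -/

section CompactIdeals

variable {A : Type u} [DistribLattice A]

theorem directedOn_principal (I : Order.Ideal A) :
    DirectedOn (· ≤ ·) (Order.Ideal.principal '' (I : Set A)) := by
  rintro _ ⟨a, ha, rfl⟩ _ ⟨b, hb, rfl⟩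
  exact ⟨_, ⟨a ⊔ b, Order.Ideal.sup_mem ha hb, rfl⟩,
    Order.Ideal.principal_le_iff.2 (Order.Ideal.mem_principal.2 le_sup_left),
    Order.Ideal.principal_le_iff.2 (Order.Ideal.mem_principal.2 le_sup_right)⟩

theorem principal_injective : Function.Injective (Order.Ideal.principal : A → Order.Ideal A) :=
  fun _ _ h => le_antisymm (Order.Ideal.mem_principal.1 (h ▸ Order.Ideal.mem_principal_self))
    (Order.Ideal.mem_principal.1 (h ▸ Order.Ideal.mem_principal_self))

variable [BoundedOrder A]

/-- The union of a nonempty directed family of ideals is already an ideal, so it bounds the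
supremum. -/
theorem mem_sSup_ideal_of_directedOn {D : Set (Order.Ideal A)} (hne : D.Nonempty)
    (hD : DirectedOn (· ≤ ·) D) {a : A} (ha : a ∈ sSup D) : ∃ I ∈ D, a ∈ I := by
  have hU : Order.IsIdeal (⋃₀ ((fun I : Order.Ideal A => (I : Set A)) '' D)) := by
    refine Order.isIdeal_sUnion_of_directedOn ?_ ?_ (hne.image _)
    · rintro _ ⟨I, -, rfl⟩
      exact I.isIdeal
    · rintro _ ⟨I, hI, rfl⟩ _ ⟨J, hJ, rfl⟩
      obtain ⟨N, hN, h1, h2⟩ := hD I hI J hJ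
      exact ⟨N, ⟨N, hN, rfl⟩, h1, h2⟩
  have hle : sSup D ≤ hU.toIdeal :=
    sSup_le fun I hI x hx => ⟨(I : Set A), ⟨I, hI, rfl⟩, hx⟩
  obtain ⟨_, ⟨I, hI, rfl⟩, h⟩ := hle ha
  exact ⟨I, hI, h⟩

theorem sSup_principal (I : Order.Ideal A) :
    sSup (Order.Ideal.principal '' (I : Set A)) = I := by
  apply le_antisymm
  · apply sSup_le
    rintro _ ⟨a, ha, rfl⟩
    exact Order.Ideal.principal_le_iff.2 ha
  · intro a ha
    exact Order.Ideal.principal_le_iff.1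
      (le_sSup (Set.mem_image_of_mem Order.Ideal.principal (SetLike.mem_coe.2 ha)))

/-- An ideal is the directed join of the principal ideals inside it, so compactness puts it below
one of them. Conversely, directed joins are unions, and a principal ideal lies in any ideal
containing its generator. -/
theorem mem_compactElements_ideal {I : Order.Ideal A} :
    I ∈ compactElements (Order.Ideal A) ↔ ∃ a, I = Order.Ideal.principal a := by
  constructor
  · intro h
    obtain ⟨_, ⟨a, ha, rfl⟩, hle⟩ := h (Order.Ideal.principal '' (I : Set A)) I
      (I.nonempty.image _) (directedOn_principal I)
      (by simpa only [sSup_principal] using isLUB_sSup (Order.Ideal.principal '' (I : Set A))) le_rfl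
    exact ⟨a, le_antisymm hle (Order.Ideal.principal_le_iff.2 ha)⟩
  · rintro ⟨a, rfl⟩ D J hne hD hJ hle
    rw [← hJ.sSup_eq, Order.Ideal.principal_le_iff] at hle
    obtain ⟨I, hI, ha⟩ := mem_sSup_ideal_of_directedOn hne hD hle
    exact ⟨I, hI, Order.Ideal.principal_le_iff.2 ha⟩

theorem mem_idealHimp {I J : Order.Ideal A} {a : A} : a ∈ I ⇨ J ↔ ∀ b ∈ I, a ⊓ b ∈ J := Iff.rfl

theorem principal_sup (a b : A) :
    Order.Ideal.principal (a ⊔ b) = Order.Ideal.principal a ⊔ Order.Ideal.principal b := by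
  ext c
  simp only [SetLike.mem_coe, Order.Ideal.mem_principal, Order.Ideal.mem_sup]
  exact ⟨fun h => ⟨a, le_rfl, b, le_rfl, h⟩, fun ⟨_, hi, _, hj, h⟩ => h.trans (sup_le_sup hi hj)⟩

theorem principal_inf (a b : A) :
    Order.Ideal.principal (a ⊓ b) = Order.Ideal.principal a ⊓ Order.Ideal.principal b := by
  ext c
  simp [Order.Ideal.mem_principal]

theorem idealMap_principal {B : Type u} [DistribLattice B] [BoundedOrder B]
    (h : BoundedLatticeHom A B) (a : A) :
    idealMap h (Order.Ideal.principal a) = Order.Ideal.principal (h a) := by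
  ext b
  exact ⟨fun ⟨c, hc, hb⟩ => hb.trans (OrderHomClass.mono h hc), fun hb => ⟨a, le_rfl, hb⟩⟩

end CompactIdeals

/-! ### The ideal functor and its full faithfulness. -/

theorem principal_himp {A : Type u} [HeytingAlgebra A] (a b : A) :
    Order.Ideal.principal (a ⇨ b) = Order.Ideal.principal a ⇨ Order.Ideal.principal b := by
  ext c
  simp only [SetLike.mem_coe, mem_idealHimp, Order.Ideal.mem_principal, le_himp_iff]
  exact ⟨fun h d hd => (inf_le_inf_left c hd).trans h, fun h => h a le_rfl⟩

theorem isHeytingFrame_ideal (A : Type u) [HeytingAlgebra A] :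
    IsHeytingFrame (Order.Ideal A) where
  algebraic I := ⟨_, by
    rintro _ ⟨a, -, rfl⟩
    exact mem_compactElements_ideal.2 ⟨a, rfl⟩, sSup_principal I⟩
  bot_mem := mem_compactElements_ideal.2 ⟨⊥, Order.Ideal.principal_bot.symm⟩
  top_mem := mem_compactElements_ideal.2 ⟨⊤, Order.Ideal.principal_top.symm⟩
  sup_mem I hI J hJ := by
    obtain ⟨a, rfl⟩ := mem_compactElements_ideal.1 hI
    obtain ⟨b, rfl⟩ := mem_compactElements_ideal.1 hJ
    exact mem_compactElements_ideal.2 ⟨_, (principal_sup a b).symm⟩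
  inf_mem I hI J hJ := by
    obtain ⟨a, rfl⟩ := mem_compactElements_ideal.1 hI
    obtain ⟨b, rfl⟩ := mem_compactElements_ideal.1 hJ
    exact mem_compactElements_ideal.2 ⟨_, (principal_inf a b).symm⟩
  himp_mem I hI J hJ := by
    obtain ⟨a, rfl⟩ := mem_compactElements_ideal.1 hI
    obtain ⟨b, rfl⟩ := mem_compactElements_ideal.1 hJ
    exact mem_compactElements_ideal.2 ⟨_, (principal_himp a b).symm⟩

/-- The functor sending a Heyting algebra `A` to its frame of ideals, and `h` to `h*`. -/
def idealFunctor : HADagger.{u} ⥤ HeytFrmDagger.{u} where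
  obj A := ⟨Order.Ideal A.obj, isHeytingFrame_ideal A.obj⟩
  map {A B} h :=
    { toCompleteLatticeHom :=
        { toFun := idealMap (A := A.obj) (B := B.obj) h.hom
          map_sInf' := by
            obtain ⟨-, φ, hφ⟩ := h.property
            rw [← hφ]
            exact map_sInf φ
          map_sSup' := by
            obtain ⟨-, φ, hφ⟩ := h.property
            rw [← hφ]
            exact map_sSup φ }
      map_himp := by
        obtain ⟨⟨φ, hφ⟩, -⟩ := h.property
        change ∀ I J, idealMap (A := A.obj) (B := B.obj) h.hom (I ⇨ J) = _
        intro I J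
        change _ = idealMap (A := A.obj) (B := B.obj) h.hom I ⇨ idealMap (A := A.obj) h.hom J
        rw [← hφ]
        exact map_himp φ I J
      map_compact := by
        intro I hI
        obtain ⟨a, rfl⟩ := mem_compactElements_ideal.1 hI
        exact mem_compactElements_ideal.2 ⟨_, idealMap_principal (A := A.obj) (B := B.obj) h.hom a⟩ }
  map_id A := by
    apply HeytFrmDagger.Hom.ext
    apply DFunLike.ext
    exact fun I => congrFun (idealMap_id (A := A.obj)) I
  map_comp {A B C} f g := by
    apply HeytFrmDagger.Hom.ext
    apply DFunLike.ext
    exact fun I => congrFun (idealMap_comp (A := A.obj) (B := B.obj) (C := C.obj) g.hom f.hom) I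

instance : idealFunctor.{u}.Faithful where
  map_injective {A B f g} h := by
    apply WideSubcategory.hom_ext
    apply DFunLike.ext (F := BoundedLatticeHom A.obj B.obj)
    intro a
    apply principal_injective
    rw [← idealMap_principal, ← idealMap_principal]
    exact DFunLike.congr_fun (congrArg HeytFrmDagger.Hom.toCompleteLatticeHom h)
      (Order.Ideal.principal a)

/-- Preservation of compactness makes `α` act on generators of principal ideals; injectivity of
`principal` transfers the lattice laws. Preservation of joins then determines `α` on all ideals. -/
theorem exists_eq_idealMap {A B : Type u} [DistribLattice A] [BoundedOrder A] [DistribLattice B]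
    [BoundedOrder B] (α : CompleteLatticeHom (Order.Ideal A) (Order.Ideal B))
    (hα : ∀ I ∈ compactElements (Order.Ideal A), α I ∈ compactElements (Order.Ideal B)) :
    ∃ h : BoundedLatticeHom A B, ⇑α = idealMap h := by
  have key (a : A) : ∃ b, α (Order.Ideal.principal a) = Order.Ideal.principal b :=
    mem_compactElements_ideal.1 (hα _ (mem_compactElements_ideal.2 ⟨a, rfl⟩))
  choose h hh using key
  refine ⟨{ toFun := h, map_sup' := ?_, map_inf' := ?_, map_top' := ?_, map_bot' := ?_ }, ?_⟩
  · intro a b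
    apply principal_injective
    rw [principal_sup, ← hh, ← hh, ← hh, principal_sup, map_sup]
  · intro a b
    apply principal_injective
    rw [principal_inf, ← hh, ← hh, ← hh, principal_inf, map_inf]
  · apply principal_injective
    rw [← hh, Order.Ideal.principal_top, Order.Ideal.principal_top, map_top]
  · apply principal_injective
    rw [← hh, Order.Ideal.principal_bot, Order.Ideal.principal_bot, map_bot]
  · funext I
    apply le_antisymm
    · conv_lhs => rw [← sSup_principal I]
      rw [map_sSup]
      apply sSup_le
      rintro _ ⟨_, ⟨a, ha, rfl⟩, rfl⟩
      rw [hh, Order.Ideal.principal_le_iff]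
      exact ⟨a, ha, le_rfl⟩
    · rintro b ⟨a, ha, hb⟩
      have h1 : α (Order.Ideal.principal a) ≤ α I :=
        OrderHomClass.mono α (Order.Ideal.principal_le_iff.2 ha)
      rw [hh] at h1
      exact h1 hb

instance : idealFunctor.{u}.Full where
  map_surjective {A B} α := by
    obtain ⟨h, hh⟩ := exists_eq_idealMap (A := A.obj) (B := B.obj) α.toCompleteLatticeHom
      α.map_compact
    let ψ : CompleteLatticeHom (Order.Ideal A.obj) (Order.Ideal B.obj) := α.toCompleteLatticeHom
    let φ : HeytingHom (Order.Ideal A.obj) (Order.Ideal B.obj) :=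
      { toFun := ψ
        map_sup' := map_sup ψ
        map_inf' := map_inf ψ
        map_bot' := map_bot ψ
        map_himp' := α.map_himp }
    refine ⟨⟨h, ⟨⟨φ, hh⟩, ⟨ψ, hh⟩⟩⟩, ?_⟩
    apply HeytFrmDagger.Hom.ext
    apply DFunLike.ext
    exact fun I => (congrFun hh I).symm

/-! ### Recovering a Heyting frame from its compact elements. -/

section CompactElements

variable {L : Type u} [Order.Frame L]

/-- The Heyting algebra of compact elements of a Heyting frame. -/
abbrev IsHeytingFrame.heytingAlgebra (hL : IsHeytingFrame L) :
    HeytingAlgebra (compactElements L) :=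
  letI : Max (compactElements L) := ⟨fun a b => ⟨a ⊔ b, hL.sup_mem a a.2 b b.2⟩⟩
  letI : Min (compactElements L) := ⟨fun a b => ⟨a ⊓ b, hL.inf_mem a a.2 b b.2⟩⟩
  letI : Top (compactElements L) := ⟨⟨⊤, hL.top_mem⟩⟩
  letI : Bot (compactElements L) := ⟨⟨⊥, hL.bot_mem⟩⟩
  letI : HImp (compactElements L) := ⟨fun a b => ⟨a ⇨ b, hL.himp_mem a a.2 b b.2⟩⟩
  letI : Compl (compactElements L) :=
    ⟨fun a => ⟨(a : L)ᶜ, by rw [← himp_bot]; exact hL.himp_mem a a.2 _ hL.bot_mem⟩⟩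
  Function.Injective.heytingAlgebra (Subtype.val : compactElements L → L)
    Subtype.val_injective Iff.rfl Iff.rfl (fun _ _ => rfl) (fun _ _ => rfl) rfl rfl
    (fun _ => rfl) (fun _ _ => rfl)

/-- A Heyting frame is the frame of ideals of its Heyting algebra of compact elements. -/
def IsHeytingFrame.orderIso (hL : IsHeytingFrame L) :
    letI := hL.heytingAlgebra
    Order.Ideal (compactElements L) ≃o L :=
  letI := hL.heytingAlgebra
  have key (I : Order.Ideal (compactElements L)) (k : compactElements L)
      (hk : (k : L) ≤ sSup (Subtype.val '' (I : Set (compactElements L)))) : k ∈ I := by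
    -- The members of `I` form a directed family, so the compact `k` lies below one of them.
    obtain ⟨_, ⟨a, ha, rfl⟩, hle⟩ := k.2 _ _ (I.nonempty.image _) (by
      rintro _ ⟨a, ha, rfl⟩ _ ⟨b, hb, rfl⟩
      exact ⟨_, ⟨a ⊔ b, Order.Ideal.sup_mem ha hb, rfl⟩, (le_sup_left : a ≤ a ⊔ b),
        (le_sup_right : b ≤ a ⊔ b)⟩) (isLUB_sSup _) hk
    exact I.lower hle ha
  { toFun I := sSup (Subtype.val '' (I : Set (compactElements L)))
    invFun l :=
      { carrier := {k | (k : L) ≤ l}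
        lower' := fun a b (hba : (b : L) ≤ a) (ha : (a : L) ≤ l) => hba.trans ha
        nonempty' := ⟨⊥, (bot_le : (⊥ : L) ≤ l)⟩
        directed' := fun a ha b hb =>
          ⟨a ⊔ b, (sup_le ha hb : (a : L) ⊔ b ≤ l), le_sup_left, le_sup_right⟩ }
    left_inv I := by
      ext k
      exact ⟨key I k, fun hk => le_sSup (Set.mem_image_of_mem Subtype.val hk)⟩
    right_inv l := by
      apply le_antisymm
      · apply sSup_le
        rintro _ ⟨k, hk, rfl⟩
        exact hk
      · obtain ⟨S, hS, rfl⟩ := hL.algebraic l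
        exact sSup_le fun s hs => le_sSup ⟨⟨s, hS hs⟩, le_sSup hs, rfl⟩
    map_rel_iff' {I J} := by
      constructor
      · intro h k hk
        exact key J k (le_trans (le_sSup (Set.mem_image_of_mem Subtype.val hk)) h)
      · intro h
        exact sSup_le_sSup (Set.image_mono h) }

end CompactElements

theorem OrderIso.map_mem_compactElements {L M : Type u} [Order.Frame L] [Order.Frame M]
    (e : L ≃o M) {a : L} (ha : a ∈ compactElements L) : e a ∈ compactElements M := by
  intro D m hne hD hm hle
  obtain ⟨_, ⟨d, hd, rfl⟩, h⟩ := ha (e.symm '' D) (e.symm m) (hne.image _) (by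
    rintro _ ⟨x, hx, rfl⟩ _ ⟨y, hy, rfl⟩
    obtain ⟨z, hz, h1, h2⟩ := hD x hx y hy
    exact ⟨_, ⟨z, hz, rfl⟩, e.symm.monotone h1, e.symm.monotone h2⟩)
    (e.symm.isLUB_image'.2 hm) (e.le_symm_apply.2 hle)
  exact ⟨d, hd, e.le_symm_apply.1 h⟩

namespace HeytFrmDagger

/-- An order isomorphism of Heyting frames, as a morphism. -/
def homOfOrderIso {L M : HeytFrmDagger.{u}} (e : L ≃o M) : L ⟶ M where
  toCompleteLatticeHom := ⟨⟨e, map_sInf e⟩, map_sSup e⟩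
  map_himp := map_himp e
  map_compact _ ha := OrderIso.map_mem_compactElements e ha

/-- An order isomorphism of Heyting frames, as an isomorphism in the category. -/
def isoOfOrderIso {L M : HeytFrmDagger.{u}} (e : L ≃o M) : L ≅ M where
  hom := homOfOrderIso e
  inv := homOfOrderIso e.symm
  hom_inv_id := Hom.ext (DFunLike.ext _ _ e.symm_apply_apply)
  inv_hom_id := Hom.ext (DFunLike.ext _ _ e.apply_symm_apply)

end HeytFrmDagger

instance : idealFunctor.{u}.EssSurj where
  mem_essImage L := by
    let := L.isHeytingFrame.heytingAlgebra
    exact ⟨⟨⟨compactElements L⟩⟩, ⟨HeytFrmDagger.isoOfOrderIso L.isHeytingFrame.orderIso⟩⟩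

instance : idealFunctor.{u}.IsEquivalence where

open TopologicalSpace (Opens)

/-! ### The frame of open upsets -/

/-- The points of `X`, with the open upsets of `X` as open sets. -/
def UpSpace (X : Type u) : Type u := X

/-- Viewing open upsets as a topology supplies the frame structure, the formula for joins and the
description of compact elements as compact open sets. -/
instance (X : Type u) [TopologicalSpace X] [PartialOrder X] : TopologicalSpace (UpSpace X) where
  IsOpen (U : Set X) := IsOpen U ∧ IsUpperSet U
  isOpen_univ := ⟨isOpen_univ, isUpperSet_univ⟩
  isOpen_inter _ _ hU hV := ⟨hU.1.inter hV.1, hU.2.inter hV.2⟩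
  isOpen_sUnion _ h := ⟨isOpen_sUnion fun U hU => (h U hU).1,
    isUpperSet_sUnion fun U hU => (h U hU).2⟩

/-- The frame of open upsets. -/
def OpenUpset (X : Type u) [TopologicalSpace X] [PartialOrder X] : Type u := Opens (UpSpace X)

theorem subset_down {X : Type u} [PartialOrder X] (S : Set X) : S ⊆ down S :=
  fun x hx => ⟨x, hx, le_rfl⟩

theorem isLowerSet_down {X : Type u} [PartialOrder X] (S : Set X) : IsLowerSet (down S) :=
  fun _ _ hba ⟨s, hs, h⟩ => ⟨s, hs, hba.trans h⟩

theorem down_eq_self {X : Type u} [PartialOrder X] {S : Set X} (hS : IsLowerSet S) : down S = S :=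
  (subset_down S).antisymm' fun _ ⟨_, hs, h⟩ => hS h hs

section OpenUpset

variable {X : Type u} [TopologicalSpace X] [PartialOrder X]

instance : Order.Frame (OpenUpset X) := inferInstanceAs (Order.Frame (Opens (UpSpace X)))

instance : SetLike (OpenUpset X) X where
  coe U := Opens.carrier (α := UpSpace X) U
  coe_injective _ _ h := Opens.ext (α := UpSpace X) h

/-- An open upset, as an element of the frame of open upsets. -/
def OpenUpset.mk (U : Set X) (hU : IsOpen U) (hU' : IsUpperSet U) : OpenUpset X :=
  (⟨U, hU, hU'⟩ : Opens (UpSpace X))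

theorem OpenUpset.isOpen (U : OpenUpset X) : IsOpen (U : Set X) := (Opens.is_open' (α := UpSpace X) U).1

theorem OpenUpset.isUpperSet (U : OpenUpset X) : IsUpperSet (U : Set X) := (Opens.is_open' (α := UpSpace X) U).2

theorem OpenUpset.mem_sSup {x : X} {S : Set (OpenUpset X)} :
    x ∈ sSup S ↔ ∃ U ∈ S, x ∈ U :=
  Opens.mem_sSup (α := UpSpace X)

end OpenUpset

/-! ### Separation in Priestley spaces, clopen upsets and exteriors. -/

section Priestley

variable {X : Type u} [TopologicalSpace X] [PartialOrder X]

variable [CompactSpace X] [PriestleySpace X]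

/-- The clopen upsets containing `x` are directed under intersection and together exclude every
point of `C`; by compactness one of them already misses `C`. -/
theorem exists_isClopen_upper_disjoint {C : Set X} (hC : IsClosed C) {x : X}
    (hx : ∀ c ∈ C, ¬ x ≤ c) : ∃ U : Set X, IsClopen U ∧ IsUpperSet U ∧ x ∈ U ∧ Disjoint C U := by
  let ι := {U : Set X // IsClopen U ∧ IsUpperSet U ∧ x ∈ U}
  have : Nonempty ι := ⟨⟨Set.univ, isClopen_univ, isUpperSet_univ, trivial⟩⟩
  obtain ⟨U, hU⟩ := hC.isCompact.elim_directed_family_closed (fun U : ι => U.1)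
    (fun U => U.2.1.isClosed) (by
      rw [Set.eq_empty_iff_forall_notMem]
      rintro c ⟨hc, hcU⟩
      obtain ⟨U, h1, h2, h3, h4⟩ := exists_isClopen_upper_of_not_le (hx c hc)
      exact h4 (Set.mem_iInter.1 hcU ⟨U, h1, h2, h3⟩))
    (fun U V => ⟨⟨U.1 ∩ V.1, U.2.1.inter V.2.1, U.2.2.1.inter V.2.2.1, U.2.2.2, V.2.2.2⟩,
      Set.inter_subset_left, Set.inter_subset_right⟩)
  exact ⟨U.1, U.2.1, U.2.2.1, U.2.2.2, Set.disjoint_iff_inter_eq_empty.2 hU⟩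

theorem isClosed_down {C : Set X} (hC : IsClosed C) : IsClosed (down C) := by
  rw [← isOpen_compl_iff, isOpen_iff_forall_mem_open]
  intro x hx
  obtain ⟨U, hU, hU', hxU, hd⟩ := exists_isClopen_upper_disjoint hC
    (fun c hc hxc => hx ⟨c, hc, hxc⟩)
  exact ⟨U, fun y hy ⟨c, hc, hyc⟩ => hd.le_bot ⟨hc, hU' hyc hy⟩, hU.isOpen, hxU⟩

theorem OpenUpset.exists_isClopen (U : OpenUpset X) {x : X} (hx : x ∈ U) :
    ∃ V : OpenUpset X, IsClopen (V : Set X) ∧ x ∈ V ∧ V ≤ U := by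
  obtain ⟨V, hV, hV', hxV, hd⟩ := exists_isClopen_upper_disjoint U.isOpen.isClosed_compl
    (x := x) (fun c hc hxc => hc (U.isUpperSet hxc hx))
  exact ⟨.mk V hV.isOpen hV', hV, hxV, Set.disjoint_compl_left_iff_subset.1 hd⟩

theorem OpenUpset.sSup_isClopen (U : OpenUpset X) :
    sSup {V : OpenUpset X | IsClopen (V : Set X) ∧ V ≤ U} = U := by
  apply le_antisymm
  · exact sSup_le fun V hV => hV.2
  · intro (x : X) hx
    obtain ⟨V, hV, hxV, hVU⟩ := U.exists_isClopen hx
    exact (OpenUpset.mem_sSup (X := X)).2 ⟨V, ⟨hV, hVU⟩, hxV⟩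

theorem mem_compactElements_openUpset {U : OpenUpset X} :
    U ∈ compactElements (OpenUpset X) ↔ IsClopen (U : Set X) := by
  constructor
  · intro h
    obtain ⟨V, ⟨hV, hVU⟩, hUV⟩ := h {V : OpenUpset X | IsClopen (V : Set X) ∧ V ≤ U} U
      ⟨⊥, isClopen_empty, bot_le⟩
      (fun V hV W hW => ⟨V ⊔ W, ⟨hV.1.union hW.1, sup_le hV.2 hW.2⟩, le_sup_left, le_sup_right⟩)
      (by simpa only [U.sSup_isClopen] using
        isLUB_sSup {V : OpenUpset X | IsClopen (V : Set X) ∧ V ≤ U}) le_rfl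
    rwa [le_antisymm hUV hVU]
  · intro h
    refine (Opens.isCompactElement_iff (α := UpSpace X) U).2 ?_
    -- The topology of `UpSpace X` is coarser, so a set compact in `X` stays compact there.
    have hid : @Continuous X (UpSpace X) _ _ (@id X) :=
      continuous_def.2 fun s (hs : IsOpen (X := X) s ∧ IsUpperSet (α := X) s) => hs.1
    have hU := @IsCompact.image X (UpSpace X) _ _ (U : Set X) (@id X) h.isClosed.isCompact hid
    exact (congrArg (IsCompact (X := UpSpace X)) (Set.image_id (U : Set X))).mp hU

/-- The largest open upset disjoint from `D`. -/
def exterior (D : Set X) : OpenUpset X :=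
  .mk (down (closure D))ᶜ (isClosed_down isClosed_closure).isOpen_compl (isLowerSet_down _).compl

/-- If `U` contains a point below some `y ∈ cl D`, it contains `y` because it is an upset, and then
meets `D` because it is open. All identities for exteriors follow from this universal property. -/
theorem le_exterior_iff {D : Set X} {U : OpenUpset X} :
    U ≤ exterior D ↔ Disjoint (U : Set X) D := by
  rw [Set.disjoint_left]
  constructor
  · exact fun h x hx hxD => h hx (subset_down _ (subset_closure hxD))
  · rintro h x hx ⟨y, hy, hxy⟩
    obtain ⟨z, hz, hzD⟩ := mem_closure_iff.1 hy U U.isOpen (U.isUpperSet hxy hx)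
    exact h hz hzD

theorem himp_eq_exterior (U V : OpenUpset X) : U ⇨ V = exterior ((U : Set X) \ V) := by
  refine eq_of_forall_le_iff fun W => ?_
  rw [le_himp_iff, le_exterior_iff, Set.disjoint_left]
  exact ⟨fun h x hx hxD => hxD.2 (h ⟨hx, hxD.1⟩),
    fun h x hx => not_not.1 fun hxV => h hx.1 ⟨hx.2, hxV⟩⟩

theorem sInf_eq_exterior (S : Set (OpenUpset X)) :
    sInf S = exterior (⋃ U ∈ S, (U : Set X)ᶜ) := by
  refine eq_of_forall_le_iff fun W => ?_
  rw [le_sInf_iff, le_exterior_iff, Set.disjoint_iUnion₂_right]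
  exact forall₂_congr fun U _ => Set.disjoint_compl_right_iff_subset.symm

theorem exterior_sUnion (F : Set (Set X)) : exterior (⋃₀ F) = ⨅ S ∈ F, exterior S := by
  refine eq_of_forall_le_iff fun W => ?_
  simp only [le_iInf_iff, le_exterior_iff, Set.disjoint_sUnion_right]

theorem coe_exterior_of_isClosed {C : Set X} (hC : IsClosed C) (hC' : IsLowerSet C) :
    (exterior C : Set X) = Cᶜ := by
  change (down (closure C))ᶜ = Cᶜ
  rw [hC.closure_eq, down_eq_self hC']

end Priestley

/-! ### Preimage maps and the dictionary between spatial and frame conditions. -/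

section Preimage

variable {X Y : Type u} [TopologicalSpace X] [PartialOrder X] [TopologicalSpace Y] [PartialOrder Y]

/-- The preimage map on open upsets of a continuous order-preserving map. -/
def upsetPreimage (f : ContinuousOrderHom X Y) : FrameHom (OpenUpset Y) (OpenUpset X) :=
  Opens.comap (α := UpSpace X) (β := UpSpace Y)
    ⟨f, ⟨fun _ (hs : IsOpen _ ∧ IsUpperSet _) => ⟨hs.1.preimage f.continuous_toFun, hs.2.preimage f.monotone'⟩⟩⟩

theorem upsetPreimage_injective [PriestleySpace Y] :
    Function.Injective (upsetPreimage : ContinuousOrderHom X Y → _) := by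
  have key (f g : ContinuousOrderHom X Y) (h : upsetPreimage f = upsetPreimage g) (x : X) :
      f x ≤ g x := by
    by_contra hx
    obtain ⟨U, hU, hU', h1, h2⟩ := exists_isClopen_upper_of_not_le hx
    have h3 : x ∈ upsetPreimage f (.mk U hU.isOpen hU') := h1
    rw [h] at h3
    exact h2 h3
  exact fun f g h => DFunLike.ext _ _ fun x => (key f g h x).antisymm (key g f h.symm x)

variable [CompactSpace X] [PriestleySpace X] [CompactSpace Y] [PriestleySpace Y]

/-- The two equations are complements of each other. -/
theorem upsetPreimage_exterior_eq_iff {f : ContinuousOrderHom X Y} {D : Set Y} :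
    upsetPreimage f (exterior D) = exterior (f ⁻¹' D) ↔
      f ⁻¹' down (closure D) = down (closure (f ⁻¹' D)) := by
  rw [← SetLike.coe_set_eq]
  exact compl_inj_iff (x := f ⁻¹' down (closure D)) (y := down (closure (f ⁻¹' D)))

/-- Exteriors turn unions into meets, so the equation need only be checked on the pieces of a union.
-/
theorem map_exterior_sUnion {f : ContinuousOrderHom X Y}
    (hf : ∀ S, upsetPreimage f (sInf S) = sInf (upsetPreimage f '' S)) {F : Set (Set Y)}
    (hF : ∀ S ∈ F, upsetPreimage f (exterior S) = exterior (f ⁻¹' S)) :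
    upsetPreimage f (exterior (⋃₀ F)) = exterior (f ⁻¹' ⋃₀ F) := by
  have h1 : f ⁻¹' ⋃₀ F = ⋃₀ ((f ⁻¹' ·) '' F) := by rw [Set.preimage_sUnion, Set.sUnion_image]
  rw [h1, exterior_sUnion, exterior_sUnion, ← sInf_image, hf, iInf_image, sInf_image, iInf_image]
  exact iInf_congr fun S => iInf_congr (hF S)

theorem esPlus_of_map {f : ContinuousOrderHom X Y}
    (hf : ∀ S, upsetPreimage f (sInf S) = sInf (upsetPreimage f '' S))
    (hf' : ∀ U V, upsetPreimage f (U ⇨ V) = upsetPreimage f U ⇨ upsetPreimage f V)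
    {E : Set Y} (hE : IsEConstructible E) :
    f ⁻¹' down (closure E) = down (closure (f ⁻¹' E)) := by
  obtain ⟨F, -, hF, rfl⟩ := hE
  refine upsetPreimage_exterior_eq_iff.1 (map_exterior_sUnion hf fun S hS => ?_)
  obtain ⟨U, V, hU, hV, rfl⟩ := hF S hS
  -- The exterior of a piece `U \ V` is an implication.
  have := hf' (.mk U hU.1 hU.2) (.mk V hV.1 hV.2)
  rwa [himp_eq_exterior, himp_eq_exterior] at this

/-- A downset is a union of principal downsets. These are closed, as are their preimages, so taking
the exterior is mere complementation on each piece. -/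
theorem esStar_of_map {f : ContinuousOrderHom X Y}
    (hf : ∀ S, upsetPreimage f (sInf S) = sInf (upsetPreimage f '' S))
    {D : Set Y} (hD : IsLowerSet D) :
    f ⁻¹' down (closure D) = down (closure (f ⁻¹' D)) := by
  have h1 : D = ⋃₀ ((fun d => down {d}) '' D) := by
    ext y
    constructor
    · exact fun hy => ⟨_, ⟨y, hy, rfl⟩, subset_down _ rfl⟩
    · rintro ⟨_, ⟨d, hd, rfl⟩, _, rfl, hy⟩
      exact hD hy hd
  rw [h1]
  refine upsetPreimage_exterior_eq_iff.1 (map_exterior_sUnion hf ?_)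
  rintro _ ⟨d, -, rfl⟩
  have hc : IsClosed (down {d}) := isClosed_down isClosed_singleton
  have hl : IsLowerSet (down {d}) := isLowerSet_down _
  apply SetLike.coe_injective
  refine Eq.trans ?_ (coe_exterior_of_isClosed (hc.preimage f.continuous_toFun)
    (hl.preimage f.monotone')).symm
  exact congrArg (f ⁻¹' ·) (coe_exterior_of_isClosed hc hl)

theorem upsetPreimage_himp {f : ContinuousOrderHom X Y}
    (hf : ∀ E : Set Y, IsEConstructible E → f ⁻¹' down (closure E) = down (closure (f ⁻¹' E)))
    (U V : OpenUpset Y) : upsetPreimage f (U ⇨ V) = upsetPreimage f U ⇨ upsetPreimage f V := by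
  rw [himp_eq_exterior, himp_eq_exterior]
  refine upsetPreimage_exterior_eq_iff.2 (hf _ ⟨{(U : Set Y) \ V}, Set.finite_singleton _, ?_,
    (Set.sUnion_singleton _).symm⟩)
  rintro _ rfl
  exact ⟨U, V, ⟨U.isOpen, U.isUpperSet⟩, ⟨V.isOpen, V.isUpperSet⟩, rfl⟩

theorem upsetPreimage_sInf {f : ContinuousOrderHom X Y}
    (hf : ∀ D : Set Y, IsLowerSet D → f ⁻¹' down (closure D) = down (closure (f ⁻¹' D)))
    (S : Set (OpenUpset Y)) : upsetPreimage f (sInf S) = sInf (upsetPreimage f '' S) := by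
  rw [sInf_eq_exterior, sInf_eq_exterior, Set.biUnion_image]
  refine (upsetPreimage_exterior_eq_iff.2 (hf _ ?_)).trans ?_
  · exact isLowerSet_iUnion₂ fun U _ => U.isUpperSet.compl
  · rw [Set.preimage_iUnion₂]
    rfl

theorem upsetPreimage_compact (f : ContinuousOrderHom X Y) {U : OpenUpset Y}
    (hU : U ∈ compactElements (OpenUpset Y)) :
    upsetPreimage f U ∈ compactElements (OpenUpset X) := by
  rw [mem_compactElements_openUpset] at hU ⊢
  exact hU.preimage f.continuous_toFun

/-- The image of `x` must lie in exactly those clopen upsets `U` with `x ∈ α U`; compactness of `Y`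
provides such a point. -/
theorem exists_eq_upsetPreimage (α : FrameHom (OpenUpset Y) (OpenUpset X))
    (hα : ∀ U ∈ compactElements (OpenUpset Y), α U ∈ compactElements (OpenUpset X)) :
    ∃ f : ContinuousOrderHom X Y, upsetPreimage f = α := by
  have key (x : X) : ∃ y : Y, ∀ U : OpenUpset Y, IsClopen (U : Set Y) → (y ∈ U ↔ x ∈ α U) := by
    -- The largest open upset whose image misses `x`, since `α` preserves joins. The required point
    -- lies outside `W` and in every clopen upset `U` with `x ∈ α U`.
    let W : OpenUpset Y := sSup {U | x ∉ α U}
    have hW : x ∉ α W := by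
      rw [map_sSup, OpenUpset.mem_sSup]
      rintro ⟨_, ⟨U, hU, rfl⟩, h⟩
      exact hU h
    let ι := {U : OpenUpset Y // IsClopen (U : Set Y) ∧ x ∈ α U}
    have : Nonempty ι := ⟨⟨⊤, isClopen_univ, by rw [map_top]; trivial⟩⟩
    obtain ⟨y, hyW, hy⟩ : ((W : Set Y)ᶜ ∩ ⋂ U : ι, (U.1 : Set Y)).Nonempty := by
      by_contra hne
      obtain ⟨U, hU⟩ := W.isOpen.isClosed_compl.isCompact.elim_directed_family_closed
        (fun U : ι => (U.1 : Set Y)) (fun U => U.2.1.isClosed) (Set.not_nonempty_iff_eq_empty.1 hne)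
        (fun U V => ⟨⟨U.1 ⊓ V.1, U.2.1.inter V.2.1, by rw [map_inf]; exact ⟨U.2.2, V.2.2⟩⟩,
          Set.inter_subset_left, Set.inter_subset_right⟩)
      have hUW : U.1 ≤ W :=
        Set.disjoint_compl_left_iff_subset.1 (Set.disjoint_iff_inter_eq_empty.2 hU)
      exact hW (OrderHomClass.mono α hUW U.2.2)
    refine ⟨y, fun U hU => ⟨fun hyU => ?_, fun hx => Set.mem_iInter.1 hy ⟨U, hU, hx⟩⟩⟩
    by_contra hx
    exact hyW ((le_sSup hx : U ≤ W) hyU)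
  choose f hf using key
  -- Open upsets are joins of clopen ones, and `α` preserves joins.
  have hf' (U : OpenUpset Y) (x : X) : f x ∈ U ↔ x ∈ α U := by
    rw [← U.sSup_isClopen, map_sSup, OpenUpset.mem_sSup, OpenUpset.mem_sSup,
      Set.exists_mem_image]
    exact exists_congr fun V => and_congr_right fun hV => hf x V hV.1
  have hmono : Monotone f := by
    intro x x' hxx'
    by_contra h
    obtain ⟨U, hU, hU', h1, h2⟩ := exists_isClopen_upper_of_not_le h
    exact h2 ((hf x' (.mk U hU.isOpen hU') hU).2
      ((α _).isUpperSet hxx' ((hf x (.mk U hU.isOpen hU') hU).1 h1)))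
  have hcont : Continuous f := by
    have hpre (U : OpenUpset Y) : f ⁻¹' (U : Set Y) = α U := Set.ext (hf' U)
    rw [continuous_iff_continuousAt]
    intro x N hN
    obtain ⟨N', hN', hNo, hxN⟩ := mem_nhds_iff.1 hN
    -- This family is closed under intersection. Once each point outside `N'` is excluded by a
    -- member, compactness gives a single member inside `N'`.
    let ι := {C : Set Y // IsClosed C ∧ f ⁻¹' C ∈ nhds x}
    have : Nonempty ι := ⟨⟨Set.univ, isClosed_univ, Filter.univ_mem⟩⟩
    obtain ⟨C, hC⟩ := hNo.isClosed_compl.isCompact.elim_directed_family_closed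
      (fun C : ι => C.1) (fun C => C.2.1) (by
        rw [Set.eq_empty_iff_forall_notMem]
        rintro y ⟨hy, hyC⟩
        have hxy : f x ≠ y := by
          rintro rfl
          exact hy hxN
        rw [Set.mem_iInter] at hyC
        by_cases hle : f x ≤ y
        -- Here `U` contains `y` but not `f x`, so the preimage of `Uᶜ` must be open; this holds
        -- because `α` sends the compact `U` to a clopen upset.
        · obtain ⟨U, hU, hU', h1, h2⟩ :=
            exists_isClopen_upper_of_not_le (fun h => hxy (hle.antisymm h))
          have h3 : IsClopen (f ⁻¹' U) := by
            rw [show f ⁻¹' U = α (.mk U hU.isOpen hU') from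
              hpre (.mk U hU.isOpen hU')]
            exact mem_compactElements_openUpset.1 (hα _ (mem_compactElements_openUpset.2 hU))
          exact hyC ⟨Uᶜ, hU.compl.isClosed, h3.compl.isOpen.mem_nhds h2⟩ h1
        · obtain ⟨U, hU, hU', h1, h2⟩ := exists_isClopen_upper_of_not_le hle
          have h3 : IsOpen (f ⁻¹' U) := by
            rw [show f ⁻¹' U = α (.mk U hU.isOpen hU') from
              hpre (.mk U hU.isOpen hU')]
            exact (α _).isOpen
          exact h2 (hyC ⟨U, hU.isClosed, h3.mem_nhds h1⟩))
      (fun C C' => ⟨⟨C.1 ∩ C'.1, C.2.1.inter C'.2.1, Filter.inter_mem C.2.2 C'.2.2⟩,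
        Set.inter_subset_left, Set.inter_subset_right⟩)
    have hCN : C.1 ⊆ N' :=
      Set.disjoint_compl_left_iff_subset.1 (Set.disjoint_iff_inter_eq_empty.2 hC)
    exact Filter.mem_of_superset C.2.2 (Set.preimage_mono (hCN.trans hN'))
  exact ⟨⟨⟨f, hmono⟩, hcont⟩, DFunLike.ext _ _ fun U => SetLike.ext fun x => hf' U x⟩

end Preimage

/-! ### The functor of open upsets and its full faithfulness. -/

theorem isHeytingFrame_openUpset (X : ESMinus.{u}) : IsHeytingFrame (OpenUpset X) where
  algebraic U := ⟨_, fun _ hV => mem_compactElements_openUpset.2 hV.1, U.sSup_isClopen⟩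
  bot_mem := mem_compactElements_openUpset.2 isClopen_empty
  top_mem := mem_compactElements_openUpset.2 isClopen_univ
  sup_mem U hU V hV := by
    rw [mem_compactElements_openUpset] at *
    exact hU.union hV
  inf_mem U hU V hV := by
    rw [mem_compactElements_openUpset] at *
    exact hU.inter hV
  himp_mem U hU V hV := by
    rw [mem_compactElements_openUpset] at *
    rw [himp_eq_exterior]
    -- The Esakia condition is what keeps clopen upsets closed under implication.
    have h := X.isClopen_down _ (hU.diff hV)
    rw [← (hU.diff hV).isClosed.closure_eq] at h
    exact h.compl

/-- The functor sending an Esakia space to its frame of open upsets. -/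
def upsetFunctor : ESDagger.{u}ᵒᵖ ⥤ HeytFrmDagger.{u} where
  obj X := ⟨OpenUpset X.unop.obj, isHeytingFrame_openUpset X.unop.obj⟩
  map {X Y} f :=
    { toCompleteLatticeHom :=
        { toFun := upsetPreimage (X := Y.unop.obj) (Y := X.unop.obj) f.unop.hom
          map_sInf' := upsetPreimage_sInf f.unop.property.2
          map_sSup' := map_sSup (upsetPreimage (X := Y.unop.obj) (Y := X.unop.obj) f.unop.hom) }
      map_himp := upsetPreimage_himp f.unop.property.1
      map_compact := fun _ =>
        upsetPreimage_compact (X := Y.unop.obj) (Y := X.unop.obj) f.unop.hom }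
  map_id _ := rfl
  map_comp _ _ := rfl

instance : upsetFunctor.{u}.Faithful where
  map_injective {X Y f g} h := by
    apply Quiver.Hom.unop_inj
    apply WideSubcategory.hom_ext
    apply upsetPreimage_injective (X := Y.unop.obj) (Y := X.unop.obj)
    apply DFunLike.ext
    exact fun U => DFunLike.congr_fun (congrArg HeytFrmDagger.Hom.toCompleteLatticeHom h) U

instance : upsetFunctor.{u}.Full where
  map_surjective {X Y} α := by
    let ψ : CompleteLatticeHom (OpenUpset X.unop.obj) (OpenUpset Y.unop.obj) :=
      α.toCompleteLatticeHom
    obtain ⟨f, hf⟩ := exists_eq_upsetPreimage (X := Y.unop.obj) (Y := X.unop.obj)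
      (ψ : FrameHom (OpenUpset X.unop.obj) (OpenUpset Y.unop.obj)) α.map_compact
    have hf' (U) : upsetPreimage f U = ψ U := DFunLike.congr_fun hf U
    have hinf (S) : upsetPreimage f (sInf S) = sInf (upsetPreimage f '' S) := by
      rw [hf]
      exact map_sInf ψ S
    have himp (U V) : upsetPreimage f (U ⇨ V) = upsetPreimage f U ⇨ upsetPreimage f V := by
      rw [hf]
      exact α.map_himp U V
    refine ⟨Quiver.Hom.op ⟨f, fun E hE => esPlus_of_map hinf himp hE,
      fun D hD => esStar_of_map hinf hD⟩, ?_⟩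
    apply HeytFrmDagger.Hom.ext
    apply DFunLike.ext
    exact hf'

/-! ### The prime spectrum of a Heyting algebra -/

section Spectrum

variable (A : Type u) [HeytingAlgebra A]

/-- The characteristic functions of prime filters. -/
def primeFilters : Set (A → Bool) :=
  {p | p ⊥ = false ∧ p ⊤ = true ∧ (∀ a b, p (a ⊔ b) = (p a || p b)) ∧
    ∀ a b, p (a ⊓ b) = (p a && p b)}

/-- Each defining equation involves finitely many coordinates, hence is a closed condition in the
compact product of copies of `Bool`. -/
theorem isClosed_primeFilters : IsClosed (primeFilters A) := by
  have h (op : Bool → Bool → Bool) (a b c : A) :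
      IsClosed {p : A → Bool | p c = op (p a) (p b)} :=
    isClosed_eq (continuous_apply c)
      (g := (fun q : Bool × Bool => op q.1 q.2) ∘ fun p : A → Bool => (p a, p b))
      (continuous_of_discreteTopology.comp ((continuous_apply a).prodMk (continuous_apply b)))
  have heq : primeFilters A = {p | p ⊥ = false} ∩ ({p | p ⊤ = true} ∩
      ((⋂ a, ⋂ b, {p | p (a ⊔ b) = (p a || p b)}) ∩
        ⋂ a, ⋂ b, {p | p (a ⊓ b) = (p a && p b)})) := by
    ext p
    simp only [primeFilters, Set.mem_inter_iff, Set.mem_iInter, Set.mem_ofPred_eq]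
  rw [heq]
  exact (isClosed_eq (continuous_apply _) continuous_const).inter
    ((isClosed_eq (continuous_apply _) continuous_const).inter
      ((isClosed_iInter fun a => isClosed_iInter fun b => h _ a b _).inter
        (isClosed_iInter fun a => isClosed_iInter fun b => h _ a b _)))

instance : CompactSpace (primeFilters A) :=
  isCompact_iff_compactSpace.1 (isClosed_primeFilters A).isCompact

variable {A}

theorem primeFilters_le_iff {x y : primeFilters A} :
    x ≤ y ↔ ∀ a, x.1 a = true → y.1 a = true :=
  forall_congr' fun _ => Bool.le_iff_imp

theorem isClopen_setOf_mem (a : A) : IsClopen {x : primeFilters A | x.1 a = true} :=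
  (isClopen_discrete {true}).preimage ((continuous_apply a).comp continuous_subtype_val)

theorem isUpperSet_setOf_mem (a : A) : IsUpperSet {x : primeFilters A | x.1 a = true} :=
  fun _ _ hxy hx => primeFilters_le_iff.1 hxy a hx

instance : PriestleySpace (primeFilters A) where
  priestley {x y} h := by
    rw [primeFilters_le_iff] at h
    push Not at h
    obtain ⟨a, hx, hy⟩ := h
    exact ⟨_, isClopen_setOf_mem a, isUpperSet_setOf_mem a, hx, hy⟩

/-- The open upset of prime filters containing `a`. -/
def basicUpset (a : A) : OpenUpset (primeFilters A) :=
  .mk _ (isClopen_setOf_mem a).isOpen (isUpperSet_setOf_mem a)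

theorem mem_basicUpset {a : A} {x : primeFilters A} : x ∈ basicUpset a ↔ x.1 a = true := Iff.rfl

theorem mem_basicUpset_sup {a b : A} {x : primeFilters A} :
    x ∈ basicUpset (a ⊔ b) ↔ x ∈ basicUpset a ∨ x ∈ basicUpset b := by
  rw [mem_basicUpset, x.2.2.2.1, Bool.or_eq_true]
  rfl

theorem mem_basicUpset_inf {a b : A} {x : primeFilters A} :
    x ∈ basicUpset (a ⊓ b) ↔ x ∈ basicUpset a ∧ x ∈ basicUpset b := by
  rw [mem_basicUpset, x.2.2.2.2, Bool.and_eq_true]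
  rfl

theorem mem_basicUpset_top (x : primeFilters A) : x ∈ basicUpset ⊤ := x.2.2.1

theorem notMem_basicUpset_bot (x : primeFilters A) : x ∉ basicUpset ⊥ := by
  rw [mem_basicUpset, x.2.1]
  exact Bool.false_ne_true

theorem basicUpset_mono {a b : A} (h : a ≤ b) : basicUpset a ≤ basicUpset b := by
  intro (x : primeFilters A) hx
  rw [← inf_eq_left.2 h] at hx
  exact (mem_basicUpset_inf.1 hx).2

/-- The prime filter is the complement of a prime ideal containing `b` and disjoint from `F`. -/
theorem exists_primeFilter (F : Order.PFilter A) {b : A} (hb : b ∉ F) :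
    ∃ x : primeFilters A, (∀ a ∈ F, x ∈ basicUpset a) ∧ x ∉ basicUpset b := by
  classical
  obtain ⟨J, hJ, hbJ, hFJ⟩ := DistribLattice.prime_ideal_of_disjoint_filter_ideal
    (F := F) (I := Order.Ideal.principal b)
    (Set.disjoint_left.2 fun c hc hcb => hb (F.mem_of_le hcb hc))
  refine ⟨⟨fun a => decide (a ∉ J), ?_, ?_, fun a c => ?_, fun a c => ?_⟩, fun a ha => ?_, ?_⟩
  · simp
  · have : ⊤ ∉ J := Order.Ideal.isProper_iff_top_notMem.1 hJ.toIsProper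
    simp [this]
  · rw [Bool.eq_iff_iff]
    simp only [decide_eq_true_eq, Bool.or_eq_true, Order.Ideal.sup_mem_iff]
    tauto
  · have : a ⊓ c ∈ J ↔ a ∈ J ∨ c ∈ J :=
      ⟨hJ.mem_or_mem, fun h => h.elim (J.lower inf_le_left) (J.lower inf_le_right)⟩
    rw [Bool.eq_iff_iff]
    simp only [decide_eq_true_eq, Bool.and_eq_true, this]
    tauto
  · exact decide_eq_true (Set.disjoint_left.1 hFJ ha)
  · rw [mem_basicUpset]
    simpa using Order.Ideal.principal_le_iff.1 hbJ

theorem basicUpset_le_iff {a b : A} : basicUpset a ≤ basicUpset b ↔ a ≤ b := by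
  refine ⟨fun h => ?_, basicUpset_mono⟩
  by_contra hab
  obtain ⟨x, hx, hxb⟩ := exists_primeFilter (Order.PFilter.principal a) (b := b) hab
  exact hxb (h (hx a le_rfl))

/-- The elements `c` with `a ⇨ c` in `x` form a filter that contains `x` and `a` but not `b`;
separate it from `b` by a prime filter. -/
theorem exists_primeFilter_ge {x : primeFilters A} {a b : A} (h : x ∉ basicUpset (a ⇨ b)) :
    ∃ y : primeFilters A, x ≤ y ∧ y ∈ basicUpset a ∧ y ∉ basicUpset b := by
  have hF : Order.IsPFilter {c : A | x ∈ basicUpset (a ⇨ c)} := by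
    refine Order.IsPFilter.of_def ⟨⊤, ?_⟩ ?_ ?_
    · rw [Set.mem_ofPred_eq, himp_top]
      exact mem_basicUpset_top x
    · intro c hc d hd
      refine ⟨c ⊓ d, ?_, inf_le_left, inf_le_right⟩
      rw [Set.mem_ofPred_eq, himp_inf_distrib]
      exact mem_basicUpset_inf.2 ⟨hc, hd⟩
    · exact fun {c d} hcd hc => basicUpset_mono (himp_le_himp_left hcd) hc
  obtain ⟨y, hy, hyb⟩ := exists_primeFilter hF.toPFilter (b := b) h
  refine ⟨y, primeFilters_le_iff.2 fun c hc => hy c ?_, hy a ?_, hyb⟩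
  · exact basicUpset_mono le_himp hc
  · change x ∈ basicUpset (a ⇨ a)
    rw [himp_self]
    exact mem_basicUpset_top x

theorem down_basicUpset_diff (a b : A) :
    down ((basicUpset a : Set (primeFilters A)) \ basicUpset b) =
      (basicUpset (a ⇨ b) : Set (primeFilters A))ᶜ := by
  ext x
  constructor
  · rintro ⟨y, ⟨hya, hyb⟩, hxy⟩ hx
    have h : y ∈ basicUpset (a ⊓ (a ⇨ b)) :=
      mem_basicUpset_inf.2 ⟨hya, (basicUpset (a ⇨ b)).isUpperSet hxy hx⟩
    exact hyb (basicUpset_mono inf_himp_le h)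
  · intro hx
    obtain ⟨y, hxy, hya, hyb⟩ := exists_primeFilter_ge hx
    exact ⟨y, ⟨hya, hyb⟩, hxy⟩

/-- The basic differences containing `x` are directed and intersect in `x` alone, so by compactness
one lies in `U`. With `down_basicUpset_diff`, this makes downsets of open sets open. -/
theorem exists_basicUpset_diff_subset {U : Set (primeFilters A)} (hU : IsOpen U)
    {x : primeFilters A} (hx : x ∈ U) : ∃ a b : A, x ∈ basicUpset a ∧ x ∉ basicUpset b ∧
      (basicUpset a : Set (primeFilters A)) \ basicUpset b ⊆ U := by
  let ι := {q : A × A // x ∈ basicUpset q.1 ∧ x ∉ basicUpset q.2}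
  have : Nonempty ι := ⟨⟨(⊤, ⊥), mem_basicUpset_top x, notMem_basicUpset_bot x⟩⟩
  obtain ⟨q, hq⟩ := hU.isClosed_compl.isCompact.elim_directed_family_closed
    (fun q : ι => (basicUpset q.1.1 : Set (primeFilters A)) \ basicUpset q.1.2)
    (fun q => ((isClopen_setOf_mem q.1.1).diff (isClopen_setOf_mem q.1.2)).isClosed) (by
      rw [Set.eq_empty_iff_forall_notMem]
      rintro y ⟨hy, hyq⟩
      rw [Set.mem_iInter] at hyq
      have hxy : x = y := by
        refine le_antisymm (primeFilters_le_iff.2 fun a ha => ?_)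
          (primeFilters_le_iff.2 fun a ha => ?_)
        · exact (hyq ⟨(a, ⊥), ha, notMem_basicUpset_bot x⟩).1
        · by_contra hxa
          exact (hyq ⟨(⊤, a), mem_basicUpset_top x, hxa⟩).2 ha
      exact hy (hxy ▸ hx))
    (fun q r => ⟨⟨(q.1.1 ⊓ r.1.1, q.1.2 ⊔ r.1.2), mem_basicUpset_inf.2 ⟨q.2.1, r.2.1⟩,
      fun h => (mem_basicUpset_sup.1 h).elim q.2.2 r.2.2⟩,
      Set.sdiff_subset_sdiff (basicUpset_mono inf_le_left) (basicUpset_mono le_sup_left),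
      Set.sdiff_subset_sdiff (basicUpset_mono inf_le_right) (basicUpset_mono le_sup_right)⟩)
  exact ⟨q.1.1, q.1.2, q.2.1, q.2.2,
    Set.disjoint_compl_left_iff_subset.1 (Set.disjoint_iff_inter_eq_empty.2 hq)⟩

theorem isOpen_down_primeFilters {U : Set (primeFilters A)} (hU : IsOpen U) :
    IsOpen (down U) := by
  rw [isOpen_iff_forall_mem_open]
  rintro x ⟨y, hy, hxy⟩
  obtain ⟨a, b, hya, hyb, hab⟩ := exists_basicUpset_diff_subset hU hy
  refine ⟨down ((basicUpset a : Set (primeFilters A)) \ basicUpset b),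
    fun z ⟨w, hw, hzw⟩ => ⟨w, hab hw, hzw⟩, ?_, ⟨y, ⟨hya, hyb⟩, hxy⟩⟩
  rw [down_basicUpset_diff]
  exact (isClopen_setOf_mem (a ⇨ b)).compl.isOpen

/-- The basic upsets containing `x` intersect in the principal upset of `x`, which lies in `U`;
compactness selects one of them. -/
theorem exists_basicUpset_le (U : OpenUpset (primeFilters A)) {x : primeFilters A} (hx : x ∈ U) :
    ∃ a : A, x ∈ basicUpset a ∧ basicUpset a ≤ U := by
  let ι := {a : A // x ∈ basicUpset a}
  have : Nonempty ι := ⟨⟨⊤, mem_basicUpset_top x⟩⟩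
  obtain ⟨a, ha⟩ := U.isOpen.isClosed_compl.isCompact.elim_directed_family_closed
    (fun a : ι => (basicUpset a.1 : Set (primeFilters A)))
    (fun a => (isClopen_setOf_mem a.1).isClosed) (by
      rw [Set.eq_empty_iff_forall_notMem]
      rintro y ⟨hy, hya⟩
      rw [Set.mem_iInter] at hya
      exact hy (U.isUpperSet (primeFilters_le_iff.2 fun a ha => hya ⟨a, ha⟩) hx))
    (fun a b => ⟨⟨a.1 ⊓ b.1, mem_basicUpset_inf.2 ⟨a.2, b.2⟩⟩,
      basicUpset_mono inf_le_left, basicUpset_mono inf_le_right⟩)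
  exact ⟨a.1, a.2, Set.disjoint_compl_left_iff_subset.1 (Set.disjoint_iff_inter_eq_empty.2 ha)⟩

theorem basicUpset_le_sSup_iff {I : Order.Ideal A} {a : A} :
    basicUpset a ≤ sSup (basicUpset '' (I : Set A)) ↔ a ∈ I := by
  constructor
  · intro h
    have ha : basicUpset a ∈ compactElements (OpenUpset (primeFilters A)) :=
      mem_compactElements_openUpset.2 (isClopen_setOf_mem a)
    -- Basic upsets are clopen, hence compact, and those indexed by `I` are directed.
    obtain ⟨_, ⟨b, hb, rfl⟩, hab⟩ := ha _ _ (I.nonempty.image basicUpset) (by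
      rintro _ ⟨b, hb, rfl⟩ _ ⟨c, hc, rfl⟩
      exact ⟨_, ⟨b ⊔ c, Order.Ideal.sup_mem hb hc, rfl⟩, basicUpset_mono le_sup_left,
        basicUpset_mono le_sup_right⟩) (isLUB_sSup _) h
    exact I.lower (basicUpset_le_iff.1 hab) hb
  · exact fun h => le_sSup (Set.mem_image_of_mem basicUpset h)

/-- The frame of ideals of a Heyting algebra is the frame of open upsets of its spectrum. -/
def idealOrderIso : Order.Ideal A ≃o OpenUpset (primeFilters A) where
  toFun I := sSup (basicUpset '' (I : Set A))
  invFun U :=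
    { carrier := {a | basicUpset a ≤ U}
      lower' := fun _ _ hba ha => (basicUpset_mono hba).trans ha
      nonempty' := ⟨⊥, fun x hx => (notMem_basicUpset_bot x hx).elim⟩
      directed' := fun a ha b hb => ⟨a ⊔ b, fun _ hx => (mem_basicUpset_sup.1 hx).elim
        (fun h => ha h) (fun h => hb h), le_sup_left, le_sup_right⟩ }
  left_inv I := by
    ext a
    exact basicUpset_le_sSup_iff
  right_inv U := by
    apply le_antisymm
    · apply sSup_le
      rintro _ ⟨a, ha, rfl⟩
      exact ha
    · intro (x : primeFilters A) hx
      obtain ⟨a, hxa, haU⟩ := exists_basicUpset_le U hx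
      exact (OpenUpset.mem_sSup (X := primeFilters A)).2 ⟨_, Set.mem_image_of_mem _ haU, hxa⟩
  map_rel_iff' {I J} := by
    refine ⟨fun h a ha => ?_, fun h => sSup_le_sSup (Set.image_mono h)⟩
    exact basicUpset_le_sSup_iff.1 ((basicUpset_le_sSup_iff.2 ha).trans h)

end Spectrum

/-- The Esakia space of prime filters of a Heyting algebra. -/
def spectrum (A : Type u) [HeytingAlgebra A] : ESMinus.{u} where
  carrier := primeFilters A
  isClopen_down _ hU := ⟨isClosed_down hU.isClosed, isOpen_down_primeFilters hU.isOpen⟩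

/-- Both the frame and the open upsets of the spectrum of its compact elements are isomorphic to the
ideal frame of those elements. -/
instance : upsetFunctor.{u}.EssSurj where
  mem_essImage L := by
    let := L.isHeytingFrame.heytingAlgebra
    exact ⟨Opposite.op ⟨spectrum (compactElements L)⟩, ⟨HeytFrmDagger.isoOfOrderIso
      (idealOrderIso.symm.trans L.isHeytingFrame.orderIso)⟩⟩

instance : upsetFunctor.{u}.IsEquivalence where

end HeytingFrames

theorem corollary3p20 :
    Nonempty (HeytingFrames.HeytFrmDagger.{u} ≌ HeytingFrames.HADagger.{u}) ∧
      Nonempty (HeytingFrames.HeytFrmDagger.{u}ᵒᵖ ≌ HeytingFrames.ESDagger.{u}) :=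
  ⟨⟨HeytingFrames.idealFunctor.asEquivalence.symm⟩,
    ⟨HeytingFrames.upsetFunctor.asEquivalence.rightOp.symm⟩⟩
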